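/- Notation. For $z=(x,\omega)\in\mathbb R^{2d}$ let $\pi(z)$ be the unitary operator $(\pi(z)\psi)(t)=e^{2\pi i\,\omega\cdot t}\psi(t-x)$ on $L^2(\mathbb R^d)$. A lattice is a set $\Lambda=A\mathbb Z^{2d}\subset\mathbb R^{2d}$ with $A\in GL(2d,\mathbb R)$. An operator $S$ on $L^2(\mathbb R^d)$ is called a density operator with respect to $\Lambda$ if $S$ is positive and trace-class and $(S,\Lambda)$ is a tight mixed-state Gabor frame with frame constant $1$, that is, $$\sum_{\lambda\in\Lambda}\langle S\,\pi(\lambda)^*\psi,\ \pi(\lambda)^*\psi\rangle=\|\psi\|^2\qquad\text{for all }\psi\in L^2(\mathbb R^d).$$ For a compact set $\Omega\subset\mathbb R^{2d}$ the mixed-state Gabor multiplier is the operator $$G^S_{\Omega,\Lambda}=\sum_{\lambda\in\Omega\cap\Lambda}\pi(\lambda)\,S\,\pi(\lambda)^*,$$ which is positive and trace-class. For $R>0$ write $R\Omega=\{R\omega:\omega\in\Omega\}$, and let $|R\Omega\cap\Lambda|$ be the number of elements of the finite set $R\Omega\cap\Lambda$. Theorem. Let $\Lambda$ be a lattice in $\mathbb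 R^{2d}$ and let $S$ be a density operator with respect to $\Lambda$. Let $\Omega\subset\mathbb R^{2d}$ be a compact set with non-empty interior whose boundary $\partial\Omega$ has Lebesgue measure zero, and fix $\delta\in(0,1)$. If $\{\lambda_k^{R\Omega}\}_k$ are the eigenvalues of $G^S_{R\Omega,\Lambda}$, counted with multiplicity, then $$\frac{\#\{k:\lambda_k^{R\Omega}>1-\delta\}}{|R\Omega\cap\Lambda|\,\operatorname{tr}(S)}\longrightarrow 1\qquad\text{as }R\to\infty.$$ -/

import Mathlib

open MeasureTheory Filter Topology
open scoped Pointwise ENNReal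

noncomputable section

namespace GaborMultiplier

/-- The Hilbert space `L²(ℝᵈ)` of complex-valued functions. -/
abbrev L2 (d : ℕ) : Type := Lp ℂ 2 (volume : Measure (EuclideanSpace ℝ (Fin d)))

/-- Phase space `ℝ²ᵈ = ℝᵈ × ℝᵈ`, with points `z = (x, ω)`. -/
abbrev Phase (d : ℕ) : Type := EuclideanSpace ℝ (Fin d) × EuclideanSpace ℝ (Fin d)

/-- The function `t ↦ e^{2πi ω·t} f(t - x)` for `z = (x, ω)`. -/
def shiftFun {d : ℕ} (z : Phase d) (f : EuclideanSpace ℝ (Fin d) → ℂ) :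
    EuclideanSpace ℝ (Fin d) → ℂ :=
  fun t => Complex.exp (2 * Real.pi * Complex.I * (inner ℝ z.2 t : ℝ)) * f (t - z.1)

theorem norm_shiftFun {d : ℕ} (z : Phase d) (f : EuclideanSpace ℝ (Fin d) → ℂ)
    (t : EuclideanSpace ℝ (Fin d)) : ‖shiftFun z f t‖ = ‖f (t - z.1)‖ := by
  have h : (2 * Real.pi * Complex.I * (inner ℝ z.2 t : ℝ) : ℂ)
      = ((2 * Real.pi * (inner ℝ z.2 t : ℝ) : ℝ) : ℂ) * Complex.I := by
    push_cast; ring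
  rw [shiftFun, norm_mul, h, Complex.norm_exp_ofReal_mul_I, one_mul]

theorem measurePreserving_sub {d : ℕ} (z : Phase d) :
    MeasurePreserving (fun t : EuclideanSpace ℝ (Fin d) => t - z.1) volume volume :=
  measurePreserving_sub_right volume z.1

theorem aestronglyMeasurable_shiftFun {d : ℕ} (z : Phase d)
    {f : EuclideanSpace ℝ (Fin d) → ℂ} (hf : AEStronglyMeasurable f volume) :
    AEStronglyMeasurable (shiftFun z f) volume := by
  refine AEStronglyMeasurable.mul ?_ (hf.comp_measurePreserving (measurePreserving_sub z))
  exact (by fun_prop : Continuous fun t : EuclideanSpace ℝ (Fin d) =>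
    Complex.exp (2 * Real.pi * Complex.I * (inner ℝ z.2 t : ℝ))).aestronglyMeasurable

theorem eLpNorm_shiftFun {d : ℕ} (z : Phase d) {f : EuclideanSpace ℝ (Fin d) → ℂ}
    (hf : AEStronglyMeasurable f volume) :
    eLpNorm (shiftFun z f) 2 volume = eLpNorm f 2 volume := by
  rw [eLpNorm_congr_norm_ae (g := f ∘ fun t => t - z.1)
    (Eventually.of_forall fun t => norm_shiftFun z f t)]
  exact eLpNorm_comp_measurePreserving hf (measurePreserving_sub z)

theorem memLp_shiftFun {d : ℕ} (z : Phase d) {f : EuclideanSpace ℝ (Fin d) → ℂ}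
    (hf : MemLp f 2 volume) : MemLp (shiftFun z f) 2 volume :=
  ⟨aestronglyMeasurable_shiftFun z hf.1, by rw [eLpNorm_shiftFun z hf.1]; exact hf.2⟩

theorem shiftFun_congr {d : ℕ} (z : Phase d) {f g : EuclideanSpace ℝ (Fin d) → ℂ}
    (h : f =ᵐ[volume] g) : shiftFun z f =ᵐ[volume] shiftFun z g := by
  filter_upwards [(measurePreserving_sub z).quasiMeasurePreserving.ae_eq_comp h] with t ht
  simp only [Function.comp_apply] at ht
  simp only [shiftFun, ht]

/-- The time-frequency shift `π(z) = M_ω T_x` as a linear isometry of `L²(ℝᵈ)`. -/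
def timeFreqShiftₗᵢ {d : ℕ} (z : Phase d) : L2 d →ₗᵢ[ℂ] L2 d where
  toFun f := (memLp_shiftFun z (Lp.memLp f)).toLp
  map_add' f g := by
    rw [← MemLp.toLp_add, MemLp.toLp_eq_toLp_iff]
    refine (shiftFun_congr z (Lp.coeFn_add f g)).trans (Eventually.of_forall fun t => ?_)
    simp only [shiftFun, Pi.add_apply, mul_add]
  map_smul' c f := by
    rw [RingHom.id_apply, ← MemLp.toLp_const_smul, MemLp.toLp_eq_toLp_iff]
    refine (shiftFun_congr z (Lp.coeFn_smul c f)).trans (Eventually.of_forall fun t => ?_)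
    simp only [shiftFun, Pi.smul_apply, smul_eq_mul]
    ring
  norm_map' f := by
    change ‖(memLp_shiftFun z (Lp.memLp f)).toLp‖ = ‖f‖
    rw [Lp.norm_toLp, eLpNorm_shiftFun z (Lp.memLp f).1, Lp.norm_def]

/-- The time-frequency shift `π(z)`, `(π(x, ω) f)(t) = e^{2πi ω·t} f(t - x)`, as a bounded
operator on `L²(ℝᵈ)`. -/
def timeFreqShift {d : ℕ} (z : Phase d) : L2 d →L[ℂ] L2 d :=
  (timeFreqShiftₗᵢ z).toContinuousLinearMap

/-- The translation `α_z(S) = π(z) S π(z)*` of an operator, which is also `δ_z ⋆ S`. -/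
def opTranslate {d : ℕ} (z : Phase d) (S : L2 d →L[ℂ] L2 d) : L2 d →L[ℂ] L2 d :=
  timeFreqShift z ∘L S ∘L (timeFreqShift z).adjoint

/-- `T` is trace-class: `∑ᵢ ⟨|T| eᵢ, eᵢ⟩ < ∞` for an orthonormal basis `(eᵢ)`, where
`|T| = √(T* T)`. The terms are non-negative and the sum does not depend on the basis. -/
def IsTraceClass {H : Type*} [NormedAddCommGroup H] [InnerProductSpace ℂ H] [CompleteSpace H]
    (T : H →L[ℂ] H) : Prop :=
  ∃ (w : Set H) (b : HilbertBasis w ℂ H),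
    Summable fun i => (inner ℂ (b i) (CFC.abs T (b i))).re

/-- Some index set of an orthonormal basis. -/
def basisSet (H : Type*) [NormedAddCommGroup H] [InnerProductSpace ℂ H] [CompleteSpace H] :
    Set H :=
  (exists_hilbertBasis ℂ H).choose

/-- Some orthonormal basis. -/
def someBasis (H : Type*) [NormedAddCommGroup H] [InnerProductSpace ℂ H] [CompleteSpace H] :
    HilbertBasis (basisSet H) ℂ H :=
  (exists_hilbertBasis ℂ H).choose_spec.choose

/-- The trace `tr T = ∑ᵢ ⟨T eᵢ, eᵢ⟩` of a trace-class operator, for some orthonormal basis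
(all of them give the same value). -/
def trace {H : Type*} [NormedAddCommGroup H] [InnerProductSpace ℂ H] [CompleteSpace H]
    (T : H →L[ℂ] H) : ℂ :=
  ∑' i, inner ℂ (someBasis H i) (T (someBasis H i))

/-- The Cohen's class distribution `Q_S(ψ)(z) = ⟨S π(z)* ψ, π(z)* ψ⟩` of a positive operator
`S` (it is then real and non-negative). -/
def cohen {d : ℕ} (S : L2 d →L[ℂ] L2 d) (ψ : L2 d) (z : Phase d) : ℝ :=
  (inner ℂ ((timeFreqShift z).adjoint ψ) (S ((timeFreqShift z).adjoint ψ))).re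

/-- `(S, Λ)` is a mixed-state Gabor frame with frame constants `A`, `B`. -/
structure IsMixedStateGaborFrame {d : ℕ} (S : L2 d →L[ℂ] L2 d) (Λ : Submodule ℤ (Phase d))
    (A B : ℝ) : Prop where
  isPositive : S.IsPositive
  isTraceClass : IsTraceClass S
  lower_pos : 0 < A
  upper_pos : 0 < B
  summable : ∀ ψ : L2 d, Summable fun l : Λ => cohen S ψ (l : Phase d)
  lower : ∀ ψ : L2 d, A * ‖ψ‖ ^ 2 ≤ ∑' l : Λ, cohen S ψ (l : Phase d)
  upper : ∀ ψ : L2 d, ∑' l : Λ, cohen S ψ (l : Phase d) ≤ B * ‖ψ‖ ^ 2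

/-- `(S, Λ)` is a tight mixed-state Gabor frame with frame constant `A`. -/
def IsTightMixedStateGaborFrame {d : ℕ} (S : L2 d →L[ℂ] L2 d) (Λ : Submodule ℤ (Phase d))
    (A : ℝ) : Prop :=
  IsMixedStateGaborFrame S Λ A A

/-- `S` is a density operator with respect to `Λ`. -/
def IsDensityOperator {d : ℕ} (S : L2 d →L[ℂ] L2 d) (Λ : Submodule ℤ (Phase d)) : Prop :=
  S.IsPositive ∧ IsTraceClass S ∧ IsTightMixedStateGaborFrame S Λ 1

/-- The mixed-state Gabor multiplier
`G_{Ω,Λ}^S = ∑_{λ ∈ Λ} χ_Ω(λ) δ_λ ⋆ S = ∑_{λ ∈ Ω ∩ Λ} π(λ) S π(λ)*`.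
The sum is finite when `Ω` is compact and `Λ` is a lattice. -/
def gaborMultiplier {d : ℕ} (S : L2 d →L[ℂ] L2 d) (Λ : Submodule ℤ (Phase d))
    (Ω : Set (Phase d)) : L2 d →L[ℂ] L2 d :=
  ∑ᶠ l ∈ Ω ∩ (Λ : Set (Phase d)), opTranslate l S

/-- The number of eigenvalues of `T` that exceed `c`, counted with multiplicity, i.e. the sum
over the real numbers `μ > c` of the dimension of the eigenspace of `μ`. For a positive compact
operator `T` and `c > 0` only finitely many terms are nonzero, and each dimension is finite. -/
def eigenvalueCount {H : Type*} [NormedAddCommGroup H] [InnerProductSpace ℂ H]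
    (T : H →L[ℂ] H) (c : ℝ) : ℕ :=
  ∑ᶠ μ ∈ Set.Ioi c,
    Module.finrank ℂ (Module.End.eigenspace (T : H →ₗ[ℂ] H) ((μ : ℝ) : ℂ))

end GaborMultiplier

end

/-!
Write `G = ∑_{λ ∈ RΩ ∩ Λ} π(λ) S π(λ)*` and `N = |RΩ ∩ Λ|`. With `B_λ = √S π(λ)*` the multiplier is
`G = ∑_{λ ∈ RΩ ∩ Λ} B_λ* B_λ`, a partial sum of the resolution of the identity
`∑_{λ ∈ Λ} B_λ* B_λ = 1` that the frame condition provides. Hence `0 ≤ G ≤ 1`, and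
`tr G = N tr S`.

On `[0, 1]` the indicator of `(1 - δ, 1]` differs from the identity function by at most a multiple
of `x (1 - x)`, so the number of eigenvalues above `1 - δ` differs from `tr G` by at most a
constant times `tr (G - G²)` (`abs_eigenvalueCount_sub_le`). It remains to see that
`tr (G - G²) = o(N)`. Since `1 - G` is the complementary partial sum,
`tr (G - G²) = ∑_{λ ∈ RΩ} ∑_{μ ∉ RΩ} ‖B_μ B_λ*‖²` in the Hilbert–Schmidt norm
(`tsum_eigenvalue_mul_one_sub`). Time-frequency shifts compose up to a phase, so
`‖B_μ B_λ*‖² = h (λ - μ)` with `h = autocorrelation S`, and the frame condition gives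
`∑_{ν ∈ Λ} h ν = tr S < ∞`. Collecting terms by `ν = λ - μ` gives (`leakage_frameOp`)
`tr (G - G²) / N = ∑_ν h ν · #{λ ∈ RΩ ∩ Λ : λ - ν ∉ RΩ} / N`.
For fixed `ν` the last quotient tends to zero, because the lattice points counted lie within a
bounded distance of `∂(RΩ)` and `∂Ω` is a null set (`tendsto_card_filter_div_card`); dominated
convergence concludes.

Traces are handled through Hilbert–Schmidt norms with values in `ℝ≥0∞` (`hsSq`), so that sums may
be exchanged freely. The eigenvalues come from the spectral theorem for compact self-adjoint
operators, applicable because Hilbert–Schmidt operators are compact.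
-/

namespace GaborMultiplier

/-! ### Hilbert–Schmidt norms -/

section HilbertSchmidt

variable {H : Type*} [NormedAddCommGroup H] [InnerProductSpace ℂ H] [CompleteSpace H]

omit [CompleteSpace H] in
/-- Parseval's identity, in `ℝ≥0∞`. -/
theorem tsum_enorm_inner_sq {ι : Type*} (b : HilbertBasis ι ℂ H) (x : H) :
    ∑' i, ‖(inner ℂ (b i) x : ℂ)‖ₑ ^ 2 = ‖x‖ₑ ^ 2 := by
  have h : HasSum (fun i => ‖(inner ℂ (b i) x : ℂ)‖ ^ 2) (‖x‖ ^ 2) := by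
    have h := Complex.hasSum_re (b.hasSum_inner_mul_inner x x)
    rw [inner_self_eq_norm_sq_to_K] at h
    convert! h using 1
    · funext i
      have h := inner_mul_symm_re_eq_norm (𝕜 := ℂ) x (b i)
      rw [norm_mul, norm_inner_symm x] at h
      rw [sq, ← h]
      rfl
    · norm_cast
  have h' := ENNReal.ofReal_tsum_of_nonneg (fun i => by positivity) h.summable
  rw [h.tsum_eq] at h'
  simpa only [ENNReal.ofReal_pow (norm_nonneg _), ofReal_norm] using h'.symm

/-- The square of the Hilbert–Schmidt norm, `∑ᵢ ‖A eᵢ‖²`, as an extended non-negative real, so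
that it makes sense for every bounded operator. By `hsSq_eq_tsum` any orthonormal basis may be
used to compute it. -/
noncomputable def hsSq (A : H →L[ℂ] H) : ℝ≥0∞ :=
  ∑' i, ‖A (someBasis H i)‖ₑ ^ 2

/-- Both sides are the sum of the squared matrix entries of `A` in the bases `b` and `c`; hence
neither depends on the choice of basis. -/
theorem tsum_enorm_sq_eq_adjoint {ι κ : Type*} (b : HilbertBasis ι ℂ H) (c : HilbertBasis κ ℂ H)
    (A : H →L[ℂ] H) : ∑' i, ‖A (b i)‖ₑ ^ 2 = ∑' j, ‖A.adjoint (c j)‖ₑ ^ 2 := by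
  simp_rw [← tsum_enorm_inner_sq c (A _), ← tsum_enorm_inner_sq b (A.adjoint _)]
  rw [ENNReal.tsum_comm]
  refine tsum_congr fun j => tsum_congr fun i => ?_
  rw [ContinuousLinearMap.adjoint_inner_right, ← inner_conj_symm, ← ofReal_norm, RCLike.norm_conj,
    ofReal_norm]

theorem hsSq_adjoint (A : H →L[ℂ] H) : hsSq A.adjoint = hsSq A :=
  (tsum_enorm_sq_eq_adjoint _ _ A).symm

theorem hsSq_eq_tsum {ι : Type*} (b : HilbertBasis ι ℂ H) (A : H →L[ℂ] H) :
    hsSq A = ∑' i, ‖A (b i)‖ₑ ^ 2 := by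
  rw [← hsSq_adjoint, hsSq, tsum_enorm_sq_eq_adjoint b]

/-- Multiplying on the left by an operator that acts isometrically does not change the
Hilbert–Schmidt norm. -/
theorem hsSq_comp_left {U : H →L[ℂ] H} (hU : ∀ x, ‖U x‖ = ‖x‖) (A : H →L[ℂ] H) :
    hsSq (U ∘L A) = hsSq A := by
  refine tsum_congr fun i => ?_
  rw [ContinuousLinearMap.comp_apply, ← ofReal_norm, hU, ofReal_norm]

/-- A Hilbert–Schmidt operator is compact: it is the norm limit of its finite rank truncations
`∑_{i ∈ s} ⟨eᵢ, A ·⟩ eᵢ`, since the tails of `∑ᵢ ‖A* eᵢ‖²` tend to zero. -/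
theorem isCompactOperator_of_hsSq_ne_top {A : H →L[ℂ] H} (hA : hsSq A ≠ ⊤) :
    IsCompactOperator A := by
  let b := someBasis H
  let P : Finset (basisSet H) → H →L[ℂ] H := fun s =>
    ∑ i ∈ s, ((innerSL ℂ (b i)).comp A).smulRight (b i)
  have hfin : ∑' i, ‖A.adjoint (b i)‖ₑ ^ 2 ≠ ⊤ := by rwa [← hsSq_adjoint] at hA
  have htail := ENNReal.tendsto_tsum_compl_atTop_zero hfin
  refine isCompactOperator_of_tendsto (l := atTop) (F := P) ?_ (Eventually.of_forall fun s => ?_)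
  · have hbd : ∀ s, ‖P s - A‖ ≤ √(∑' i : {i // i ∉ s}, ‖A.adjoint (b i)‖ₑ ^ 2).toReal := by
      intro s
      set t := ∑' i : {i // i ∉ s}, ‖A.adjoint (b i)‖ₑ ^ 2
      have ht : t ≠ ⊤ := ne_top_of_le_ne_top hfin
        (ENNReal.tsum_comp_le_tsum_of_injective Subtype.val_injective _)
      refine ContinuousLinearMap.opNorm_le_bound _ (by positivity) fun x => ?_
      -- The coefficients of `A x` indexed by `s` cancel; the others are bounded by Cauchy–Schwarz.
      have hcoef : ∀ j, ‖(inner ℂ (b j) ((P s - A) x) : ℂ)‖ₑ ^ 2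
          ≤ ({j | j ∉ s} : Set _).indicator (fun j => ‖A.adjoint (b j)‖ₑ ^ 2) j * ‖x‖ₑ ^ 2 := by
        intro j
        have hP : P s x = ∑ i ∈ s, (inner ℂ (b i) (A x) : ℂ) • b i := by
          simp [P]
        rw [sub_apply, inner_sub_right, hP]
        by_cases hj : j ∈ s
        · rw [b.orthonormal.inner_right_sum _ hj]
          simp
        · have h0 : (inner ℂ (b j) (∑ i ∈ s, (inner ℂ (b i) (A x) : ℂ) • b i) : ℂ) = 0 := by
            rw [inner_sum]
            refine Finset.sum_eq_zero fun i hi => ?_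
            rw [inner_smul_right, b.orthonormal.inner_eq_zero (ne_of_mem_of_not_mem hi hj).symm, mul_zero]
          rw [h0, zero_sub, enorm_neg, Set.indicator_of_mem (by exact hj), ← mul_pow,
            ← ContinuousLinearMap.adjoint_inner_left]
          gcongr
          simp_rw [← ofReal_norm]
          rw [← ENNReal.ofReal_mul (norm_nonneg _)]
          exact ENNReal.ofReal_le_ofReal (norm_inner_le_norm _ _)
      have hsq : ‖(P s - A) x‖ₑ ^ 2 ≤ t * ‖x‖ₑ ^ 2 := by
        rw [← tsum_enorm_inner_sq b]
        refine (ENNReal.tsum_le_tsum hcoef).trans_eq ?_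
        rw [ENNReal.tsum_mul_right, ← tsum_subtype]
        rfl
      rw [← Real.sqrt_sq (norm_nonneg x), ← Real.sqrt_mul ENNReal.toReal_nonneg]
      refine Real.le_sqrt_of_sq_le ?_
      have h := ENNReal.toReal_mono (by finiteness) hsq
      simpa using h
    rw [tendsto_iff_norm_sub_tendsto_zero]
    refine squeeze_zero (fun _ => norm_nonneg _) hbd ?_
    have h0 := (Real.continuous_sqrt.tendsto _).comp
      ((ENNReal.tendsto_toReal ENNReal.zero_ne_top).comp htail)
    simpa [Function.comp_def] using h0
  · have hmem : P s ∈ compactOperator (RingHom.id ℂ) H H := by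
      refine Submodule.sum_mem _ fun i _ => ?_
      have hid : IsCompactOperator (id : ℂ → ℂ) :=
        (isCompactOperator_id_iff_finiteDimensional (𝕜 := ℂ)).mpr inferInstance
      exact (hid.comp_clm ((innerSL ℂ (b i)).comp A)).clm_comp
        (ContinuousLinearMap.toSpanSingleton ℂ (b i))
    exact hmem

end HilbertSchmidt

/-! ### Eigenvalues of compact self-adjoint operators -/

section Spectral

universe u

variable {H : Type u} [NormedAddCommGroup H] [InnerProductSpace ℂ H] [CompleteSpace H]

/-- Orthonormal bases of the members of an orthogonal family of subspaces with dense sum combine to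
an orthonormal basis of the whole space. -/
theorem exists_hilbertBasis_of_orthogonalFamily {α : Type*} {V : α → Submodule ℂ H}
    [∀ a, CompleteSpace (V a)] (hV : OrthogonalFamily ℂ (fun a => V a) fun a => (V a).subtypeₗᵢ)
    (hV' : (⨆ a, V a)ᗮ = ⊥) :
    ∃ (w : ∀ a, Set (V a)) (b : HilbertBasis (Σ a, w a) ℂ H), ∀ i, b i ∈ V i.1 := by
  choose w c hc using fun a => exists_hilbertBasis ℂ (V a)
  have ho : Orthonormal ℂ fun i : Σ a, w a => (V i.1).subtypeₗᵢ (c i.1 i.2) :=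
    hV.orthonormal_sigma_orthonormal fun a => (c a).orthonormal
  have hsp : (Submodule.span ℂ
      (Set.range fun i : Σ a, w a => (V i.1).subtypeₗᵢ (c i.1 i.2)))ᗮ = ⊥ := by
    rw [← le_bot_iff, ← hV', ← Submodule.iInf_orthogonal]
    refine le_iInf fun a x hx v hv => ?_
    -- Expanding `v` in the basis of `V a`, every term of `⟪x, v⟫` vanishes.
    have hsum := ((innerSL ℂ x).comp (V a).subtypeL).hasSum ((c a).hasSum_repr ⟨v, hv⟩)
    have hzero : ∀ j, ((innerSL ℂ x).comp (V a).subtypeL) ((c a).repr ⟨v, hv⟩ j • c a j) = 0 := by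
      intro j
      have h0 : inner ℂ ((c a j : V a) : H) x = 0 :=
        hx _ (Submodule.subset_span ⟨⟨a, j⟩, rfl⟩)
      rw [map_smul]
      simp [inner_eq_zero_symm.mp h0]
    simp only [hzero] at hsum
    exact inner_eq_zero_symm.mp (hsum.unique hasSum_zero)
  refine ⟨w, HilbertBasis.mkOfOrthogonalEqBot ho hsp, fun i => ?_⟩
  rw [HilbertBasis.coe_mkOfOrthogonalEqBot]
  exact (c i.1 i.2).2

/-- The spectral theorem: a compact self-adjoint operator has an orthonormal basis of
eigenvectors. -/
theorem exists_hilbertBasis_eigenvectors {T : H →L[ℂ] H} (hT : IsCompactOperator T)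
    (hT' : T.IsSymmetric) :
    ∃ (ι : Type u) (b : HilbertBasis ι ℂ H) (l : ι → ℝ),
      ∀ i, T (b i) = (l i : ℂ) • b i := by
  have : ∀ μ, CompleteSpace (Module.End.eigenspace (T : Module.End ℂ H) μ) := fun μ => by
    have : IsClosed (Module.End.eigenspace (T : Module.End ℂ H) μ : Set H) := by
      have h : (Module.End.eigenspace (T : Module.End ℂ H) μ : Set H) = {x | T x = μ • x} := by
        ext x
        simp
      rw [h]
      exact isClosed_eq T.continuous (by fun_prop)
    exact this.completeSpace_coe
  obtain ⟨w, b, hb⟩ := exists_hilbertBasis_of_orthogonalFamily hT'.orthogonalFamily_eigenspaces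
    (ContinuousLinearMap.orthogonalComplement_iSup_eigenspaces_eq_bot hT hT')
  refine ⟨_, b, fun i => i.1.re, fun i => ?_⟩
  have h1 : T (b i) = i.1 • b i := by simpa using hb i
  have h2 := hT'.conj_eigenvalue_eq_self (μ := i.1)
    (Module.End.hasEigenvalue_of_hasEigenvector ⟨hb i, b.orthonormal.ne_zero i⟩)
  rw [h1, Complex.conj_eq_iff_re.mp h2]

omit [CompleteSpace H] in
theorem inner_eigenvector_apply {ι : Type*} {T : H →L[ℂ] H} (hT : T.IsSymmetric)
    {b : HilbertBasis ι ℂ H} {l : ι → ℝ} (hb : ∀ i, T (b i) = (l i : ℂ) • b i) (i : ι) (x : H) :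
    inner ℂ (b i) (T x) = l i * inner ℂ (b i) x := by
  have := hT (b i) x
  simp only [ContinuousLinearMap.coe_coe] at this
  rw [← this, hb, inner_smul_left, Complex.conj_ofReal]

omit [CompleteSpace H] in
theorem finrank_eigenspace_eq_ncard {ι : Type*} {T : H →L[ℂ] H} (hT : T.IsSymmetric)
    {b : HilbertBasis ι ℂ H} {l : ι → ℝ} (hb : ∀ i, T (b i) = (l i : ℂ) • b i) {μ : ℝ}
    (hfin : {i | l i = μ}.Finite) :
    Module.finrank ℂ (Module.End.eigenspace (T : H →ₗ[ℂ] H) (μ : ℂ)) = {i | l i = μ}.ncard := by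
  have hspan : Module.End.eigenspace (T : H →ₗ[ℂ] H) (μ : ℂ)
      = Submodule.span ℂ (Set.range fun i : {i | l i = μ} => b i) := by
    refine le_antisymm (fun v hv => ?_) (Submodule.span_le.mpr ?_)
    · have hv' : T v = (μ : ℂ) • v := by simpa using hv
      have hzero : ∀ i ∉ hfin.toFinset, b.repr v i • b i = 0 := by
        intro i hi
        have h1 := inner_eigenvector_apply hT hb i v
        rw [hv', inner_smul_right] at h1
        have h2 : (μ : ℂ) ≠ l i := fun h => hi (by simpa using (Complex.ofReal_injective h).symm)
        have h3 : (inner ℂ (b i) v : ℂ) = 0 := by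
          by_contra h
          exact h2 (mul_right_cancel₀ h h1)
        rw [b.repr_apply_apply, h3, zero_smul]
      rw [(b.hasSum_repr v).unique (hasSum_sum_of_ne_finset_zero hzero)]
      refine Submodule.sum_mem _ fun i hi => Submodule.smul_mem _ _ (Submodule.subset_span ?_)
      exact ⟨⟨i, by simpa using hi⟩, rfl⟩
    · rintro _ ⟨i, rfl⟩
      have hi : l i = μ := i.2
      simpa [hi] using hb i
  have := hfin.fintype
  have hli : LinearIndependent ℂ fun i : {i | l i = μ} => b i :=
    b.orthonormal.linearIndependent.comp _ Subtype.val_injective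
  rw [hspan, finrank_span_eq_card hli, ← Nat.card_eq_fintype_card, Nat.card_coe_set_eq]

omit [CompleteSpace H] in
/-- The eigenvalues above `c`, counted with multiplicity, can be counted in any orthonormal basis
of eigenvectors. -/
theorem eigenvalueCount_eq_ncard {ι : Type*} {T : H →L[ℂ] H} (hT : T.IsSymmetric)
    {b : HilbertBasis ι ℂ H} {l : ι → ℝ} (hb : ∀ i, T (b i) = (l i : ℂ) • b i) {c : ℝ}
    (hfin : {i | c < l i}.Finite) :
    eigenvalueCount T c = {i | c < l i}.ncard := by
  classical
  have h1 : ∀ μ ∈ Set.Ioi c, Module.finrank ℂ (Module.End.eigenspace (T : H →ₗ[ℂ] H) (μ : ℂ))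
      = (hfin.toFinset.filter fun i => l i = μ).card := by
    intro μ hμ
    have hsub : {i | l i = μ} ⊆ {i | c < l i} := fun i hi => by
      simpa [Set.mem_ofPred_eq.mp hi] using hμ
    rw [finrank_eigenspace_eq_ncard hT hb (hfin.subset hsub),
      Set.ncard_eq_toFinset_card _ (hfin.subset hsub)]
    congr 1
    ext i
    simp only [Set.Finite.mem_toFinset, Set.mem_ofPred_eq, Finset.mem_filter]
    exact ⟨fun h => ⟨hsub h, h⟩, fun h => h.2⟩
  rw [eigenvalueCount, finsum_mem_congr rfl h1,
    finsum_mem_eq_sum_of_inter_support_eq (t := hfin.toFinset.image l)]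
  · rw [Set.ncard_eq_toFinset_card _ hfin]
    exact (Finset.card_eq_sum_card_image l hfin.toFinset).symm
  · ext μ
    simp only [Set.mem_inter_iff, Set.mem_Ioi, Function.mem_support, Finset.coe_image,
      Set.mem_image, Finset.mem_coe, Set.Finite.mem_toFinset, Set.mem_ofPred_eq]
    refine and_congr_left fun h => ⟨fun hμ => ?_, ?_⟩
    · obtain ⟨i, hi⟩ := Finset.card_ne_zero.mp h
      simp at hi
      exact ⟨i, hi⟩
    · rintro ⟨i, hi, rfl⟩
      exact hi

end Spectral

/-! ### Eigenvalue counting for partial sums of a resolution of the identity -/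

section Localization

universe u
variable {H : Type u} [NormedAddCommGroup H] [InnerProductSpace ℂ H] [CompleteSpace H]
  {ι : Type*} (B : ι → H →L[ℂ] H) (F : Finset ι)

/-- The partial sum `∑_{i ∈ F} Bᵢ* Bᵢ`. -/
noncomputable def partialFrameOp : H →L[ℂ] H :=
  ∑ i ∈ F, (B i).adjoint ∘L B i

variable {B F}

theorem inner_partialFrameOp (x y : H) :
    inner ℂ x (partialFrameOp B F y) = ∑ i ∈ F, inner ℂ (B i x) (B i y) := by
  simp [partialFrameOp, ContinuousLinearMap.adjoint_inner_right]

theorem isSymmetric_partialFrameOp : (partialFrameOp B F).IsSymmetric := by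
  intro x y
  have h := inner_partialFrameOp (B := B) (F := F) y x
  simp only [ContinuousLinearMap.coe_coe]
  rw [← inner_conj_symm, h, inner_partialFrameOp, map_sum]
  simp

theorem isCompactOperator_partialFrameOp (hB : ∀ i ∈ F, hsSq (B i) ≠ ⊤) :
    IsCompactOperator (partialFrameOp B F) := by
  have hmem : partialFrameOp B F ∈ compactOperator (RingHom.id ℂ) H H :=
    Submodule.sum_mem _ fun i hi =>
      (isCompactOperator_of_hsSq_ne_top (hB i hi)).clm_comp (B i).adjoint
  exact hmem

/-- The off-diagonal interaction `∑_{i ∈ F} ∑_{j ∉ F} ‖B_j Bᵢ*‖²_{HS}`. When the `Bᵢ* Bᵢ` resolve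
the identity, this is the trace of `T - T²` for `T = ∑_{i ∈ F} Bᵢ* Bᵢ`. -/
noncomputable def leakage (B : ι → H →L[ℂ] H) (F : Finset ι) : ℝ≥0∞ :=
  ∑ i ∈ F, ∑' j : {j // j ∉ F}, hsSq (B j ∘L (B i).adjoint)

section Eigenbasis

variable {κ : Type*} {b : HilbertBasis κ ℂ H} {l : κ → ℝ}

theorem ofReal_eigenvalue_partialFrameOp (hb : ∀ k, partialFrameOp B F (b k) = (l k : ℂ) • b k)
    (k : κ) : 0 ≤ l k ∧ ENNReal.ofReal (l k) = ∑ i ∈ F, ‖B i (b k)‖ₑ ^ 2 := by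
  have h := inner_partialFrameOp (B := B) (F := F) (b k) (b k)
  have h' : l k = ∑ i ∈ F, ‖B i (b k)‖ ^ 2 := by
    rw [hb, inner_smul_right, inner_self_eq_norm_sq_to_K, b.orthonormal.norm_eq_one] at h
    simp only [inner_self_eq_norm_sq_to_K] at h
    norm_num at h
    exact_mod_cast h
  refine ⟨h' ▸ by positivity, ?_⟩
  rw [h', ENNReal.ofReal_sum_of_nonneg fun i _ => by positivity]
  simp [ENNReal.ofReal_pow]

theorem eigenvalue_partialFrameOp_le_one (hres : ∀ x, ∑' i, ‖B i x‖ₑ ^ 2 = ‖x‖ₑ ^ 2)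
    (hb : ∀ k, partialFrameOp B F (b k) = (l k : ℂ) • b k) (k : κ) : l k ≤ 1 := by
  rw [← ENNReal.ofReal_le_one, (ofReal_eigenvalue_partialFrameOp hb k).2]
  refine (ENNReal.sum_le_tsum F).trans_eq ?_
  rw [hres, ← ofReal_norm, b.orthonormal.norm_eq_one]
  simp

/-- The trace of the partial sum, as the sum of its eigenvalues. -/
theorem tsum_eigenvalue_partialFrameOp
    (hb : ∀ k, partialFrameOp B F (b k) = (l k : ℂ) • b k) :
    ∑' k, ENNReal.ofReal (l k) = ∑ i ∈ F, hsSq (B i) := by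
  simp_rw [(ofReal_eigenvalue_partialFrameOp hb _).2, hsSq_eq_tsum b]
  exact Summable.tsum_finsetSum fun _ _ => ENNReal.summable

/-- The quadratic form of the partial sum, in its own eigenbasis. -/
theorem tsum_ofReal_mul_enorm_inner_sq (hb : ∀ k, partialFrameOp B F (b k) = (l k : ℂ) • b k)
    (x : H) :
    ∑' k, ENNReal.ofReal (l k) * ‖(inner ℂ (b k) x : ℂ)‖ₑ ^ 2 = ∑ i ∈ F, ‖B i x‖ₑ ^ 2 := by
  have h : HasSum (fun k => l k * ‖(inner ℂ (b k) x : ℂ)‖ ^ 2) (∑ i ∈ F, ‖B i x‖ ^ 2) := by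
    have h := Complex.hasSum_re (b.hasSum_inner_mul_inner x (partialFrameOp B F x))
    simp_rw [inner_eigenvector_apply isSymmetric_partialFrameOp hb, inner_partialFrameOp,
      inner_self_eq_norm_sq_to_K] at h
    convert! h using 1
    · funext k
      have h := inner_mul_symm_re_eq_norm (𝕜 := ℂ) x (b k)
      rw [norm_mul, norm_inner_symm x, ← sq] at h
      rw [← h, mul_left_comm, Complex.re_ofReal_mul]
      rfl
    · norm_cast
  have h' := ENNReal.ofReal_tsum_of_nonneg (fun k => mul_nonneg
    (ofReal_eigenvalue_partialFrameOp hb k).1 (by positivity)) h.summable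
  rw [h.tsum_eq, ENNReal.ofReal_sum_of_nonneg fun i _ => by positivity] at h'
  simp_rw [ENNReal.ofReal_mul (ofReal_eigenvalue_partialFrameOp hb _).1,
    ENNReal.ofReal_pow (norm_nonneg _), ofReal_norm] at h'
  exact h'.symm

/-- The quadratic form of `1 - T`, for the partial sum `T`, in the eigenbasis of `T`. -/
theorem tsum_ofReal_one_sub_mul_enorm_inner_sq (hres : ∀ x, ∑' i, ‖B i x‖ₑ ^ 2 = ‖x‖ₑ ^ 2)
    (hb : ∀ k, partialFrameOp B F (b k) = (l k : ℂ) • b k) (x : H) :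
    ∑' k, ENNReal.ofReal (1 - l k) * ‖(inner ℂ (b k) x : ℂ)‖ₑ ^ 2
      = ∑' j : {j // j ∉ F}, ‖B j x‖ₑ ^ 2 := by
  have h1 : ∑ i ∈ F, ‖B i x‖ₑ ^ 2 + ∑' j : {j // j ∉ F}, ‖B j x‖ₑ ^ 2 = ‖x‖ₑ ^ 2 := by
    rw [← hres]
    have h := Summable.tsum_add_tsum_compl (s := (F : Set ι)) (f := fun i => ‖B i x‖ₑ ^ 2)
      ENNReal.summable ENNReal.summable
    rw [← h]
    congr 1
    exact (Finset.tsum_subtype' F fun i => ‖B i x‖ₑ ^ 2).symm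
  have h2 : ∑ i ∈ F, ‖B i x‖ₑ ^ 2
      + ∑' k, ENNReal.ofReal (1 - l k) * ‖(inner ℂ (b k) x : ℂ)‖ₑ ^ 2 = ‖x‖ₑ ^ 2 := by
    rw [← tsum_ofReal_mul_enorm_inner_sq hb, ← ENNReal.tsum_add, ← tsum_enorm_inner_sq b x]
    refine tsum_congr fun k => ?_
    rw [← add_mul, ← ENNReal.ofReal_add (ofReal_eigenvalue_partialFrameOp hb k).1
      (sub_nonneg.mpr (eigenvalue_partialFrameOp_le_one hres hb k))]
    simp
  -- Both tails complement the same finite amount to `‖x‖²`.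
  refine (ENNReal.add_right_inj ?_).mp (h2.trans h1.symm)
  exact ne_top_of_le_ne_top (by finiteness : ‖x‖ₑ ^ 2 ≠ ⊤) (h1 ▸ self_le_add_right _ _)

/-- The trace of `T - T²`, for the partial sum `T`. On the one hand
`⟪e_k, T e_k⟫ = ∑_{i ∈ F} ‖Bᵢ e_k‖²`; on the other, expanding `Bᵢ e_k` in the eigenbasis turns
`∑_k (1 - l_k) ‖Bᵢ e_k‖²` into the trace of `Bᵢ (1 - T) Bᵢ*`, and `1 - T` is the complementary partial
sum. -/
theorem tsum_eigenvalue_mul_one_sub (hres : ∀ x, ∑' i, ‖B i x‖ₑ ^ 2 = ‖x‖ₑ ^ 2)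
    (hb : ∀ k, partialFrameOp B F (b k) = (l k : ℂ) • b k) :
    ∑' k, ENNReal.ofReal (l k * (1 - l k)) = leakage B F := by
  have h1 : ∀ i, ∑' k, ENNReal.ofReal (1 - l k) * ‖B i (b k)‖ₑ ^ 2
      = ∑' j : {j // j ∉ F}, hsSq (B j ∘L (B i).adjoint) := by
    intro i
    simp_rw [hsSq_eq_tsum b]
    rw [ENNReal.tsum_comm]
    simp_rw [ContinuousLinearMap.comp_apply, ← tsum_ofReal_one_sub_mul_enorm_inner_sq hres hb]
    rw [ENNReal.tsum_comm]
    refine tsum_congr fun k => ?_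
    rw [← tsum_enorm_inner_sq b, ← ENNReal.tsum_mul_left]
    refine tsum_congr fun m => ?_
    rw [ContinuousLinearMap.adjoint_inner_right, ← inner_conj_symm, ← ofReal_norm,
      RCLike.norm_conj, ofReal_norm]
  rw [leakage, ← Finset.sum_congr rfl fun i _ => h1 i,
    ← Summable.tsum_finsetSum fun _ _ => ENNReal.summable]
  refine tsum_congr fun k => ?_
  rw [ENNReal.ofReal_mul (ofReal_eigenvalue_partialFrameOp hb k).1,
    (ofReal_eigenvalue_partialFrameOp hb k).2, mul_comm, Finset.mul_sum]

end Eigenbasis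

/-- For a sequence in `[0, 1]` with finite sum, the number of terms above `1 - δ` differs from the
sum by at most a multiple of `∑ l (1 - l)`. -/
theorem abs_ncard_sub_tsum_le {κ : Type*} {l : κ → ℝ} (h0 : ∀ k, 0 ≤ l k) (h1 : ∀ k, l k ≤ 1)
    (hl : Summable l) {δ : ℝ} (hδ : δ ∈ Set.Ioo (0 : ℝ) 1) :
    {k | 1 - δ < l k}.Finite ∧ |({k | 1 - δ < l k}.ncard : ℝ) - ∑' k, l k|
      ≤ (1 / δ + 1 / (1 - δ)) * ∑' k, l k * (1 - l k) := by
  obtain ⟨hδ0, hδ1⟩ := hδ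
  have hδ1' : 0 < 1 - δ := sub_pos.mpr hδ1
  have hfin : {k | 1 - δ < l k}.Finite := by
    have h := hl.tendsto_cofinite_zero.eventually (gt_mem_nhds hδ1')
    exact (eventually_cofinite.mp h).subset fun k hk => not_lt.mpr (le_of_lt hk)
  refine ⟨hfin, ?_⟩
  have hs : Summable fun k => l k * (1 - l k) :=
    hl.of_nonneg_of_le (fun k => mul_nonneg (h0 k) (sub_nonneg.mpr (h1 k)))
      fun k => mul_le_of_le_one_right (h0 k) (by linarith [h0 k])
  have hind : HasSum ({k | 1 - δ < l k}.indicator fun _ => (1 : ℝ)) {k | 1 - δ < l k}.ncard := by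
    have h := hasSum_sum_of_ne_finset_zero (s := hfin.toFinset) (L := SummationFilter.unconditional _)
      (f := {k | 1 - δ < l k}.indicator fun _ => (1 : ℝ)) (fun k hk => by simpa using hk)
    convert h using 1
    rw [Finset.sum_congr rfl fun k hk => Set.indicator_of_mem (by simpa using hk) _,
      Set.ncard_eq_toFinset_card _ hfin]
    simp
  rw [← hind.tsum_eq, ← hind.summable.tsum_sub hl, ← tsum_mul_left, ← Real.norm_eq_abs]
  refine tsum_of_norm_bounded (hs.mul_left _).hasSum fun k => ?_
  rw [Real.norm_eq_abs]
  have hk := mul_nonneg (h0 k) (sub_nonneg.mpr (h1 k))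
  -- Above the threshold the factor `l` is at least `1 - δ`; below it `1 - l` is at least `δ`.
  by_cases hkδ : 1 - δ < l k
  · rw [Set.indicator_of_mem (by exact hkδ), abs_of_nonneg (sub_nonneg.mpr (h1 k))]
    calc 1 - l k ≤ 1 / (1 - δ) * (l k * (1 - l k)) := by
          rw [div_mul_eq_mul_div, one_mul, le_div_iff₀ hδ1', mul_comm]
          exact mul_le_mul_of_nonneg_right hkδ.le (sub_nonneg.mpr (h1 k))
      _ ≤ _ := mul_le_mul_of_nonneg_right (le_add_of_nonneg_left (by positivity)) hk
  · rw [Set.indicator_of_notMem (by exact hkδ), zero_sub, abs_neg, abs_of_nonneg (h0 k)]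
    calc l k ≤ 1 / δ * (l k * (1 - l k)) := by
          rw [div_mul_eq_mul_div, one_mul, le_div_iff₀ hδ0]
          exact mul_le_mul_of_nonneg_left (by linarith) (h0 k)
      _ ≤ _ := mul_le_mul_of_nonneg_right (le_add_of_nonneg_right (by positivity)) hk

/-- The number of eigenvalues above `1 - δ` differs from the trace by at most a multiple of the
leakage. -/
theorem abs_eigenvalueCount_sub_le (hres : ∀ x, ∑' i, ‖B i x‖ₑ ^ 2 = ‖x‖ₑ ^ 2)
    (hB : ∀ i ∈ F, hsSq (B i) ≠ ⊤) {δ : ℝ} (hδ : δ ∈ Set.Ioo (0 : ℝ) 1) :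
    |(eigenvalueCount (partialFrameOp B F) (1 - δ) : ℝ) - (∑ i ∈ F, hsSq (B i)).toReal|
      ≤ (1 / δ + 1 / (1 - δ)) * (leakage B F).toReal := by
  obtain ⟨κ, b, l, hb⟩ := exists_hilbertBasis_eigenvectors (isCompactOperator_partialFrameOp hB)
    isSymmetric_partialFrameOp
  have h0 := fun k => (ofReal_eigenvalue_partialFrameOp hb k).1
  have h1 := eigenvalue_partialFrameOp_le_one hres hb
  have hsum := tsum_eigenvalue_partialFrameOp hb
  have hl : Summable l := by
    have h := ENNReal.summable_toReal (f := fun k => ENNReal.ofReal (l k)) (by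
      rw [hsum]
      exact ENNReal.sum_ne_top.mpr hB)
    simpa [ENNReal.toReal_ofReal (h0 _)] using h
  obtain ⟨hfin, h⟩ := abs_ncard_sub_tsum_le h0 h1 hl hδ
  rw [eigenvalueCount_eq_ncard isSymmetric_partialFrameOp hb hfin, ← hsum,
    ← tsum_eigenvalue_mul_one_sub hres hb, ENNReal.tsum_toReal_eq fun _ => ENNReal.ofReal_ne_top,
    ENNReal.tsum_toReal_eq fun _ => ENNReal.ofReal_ne_top]
  simpa [ENNReal.toReal_ofReal (h0 _),
    ENNReal.toReal_ofReal (mul_nonneg (h0 _) (sub_nonneg.mpr (h1 _)))] using h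

end Localization

/-! ### Square roots and traces of positive operators -/

section Sqrt

variable {H : Type*} [NormedAddCommGroup H] [InnerProductSpace ℂ H] [CompleteSpace H]
  {S : H →L[ℂ] H}

/-- The positive square root. It wraps `CFC.sqrt`, for which the functional calculus is available on
an abstract Hilbert space, whereas instance search does not find it on `L2 d`. -/
noncomputable def posSqrt (S : H →L[ℂ] H) : H →L[ℂ] H :=
  CFC.sqrt S

theorem adjoint_posSqrt (S : H →L[ℂ] H) :
    (posSqrt S).adjoint = posSqrt S :=
  (CFC.sqrt_nonneg S).isSelfAdjoint.star_eq

theorem posSqrt_comp_posSqrt (hS : S.IsPositive) : posSqrt S ∘L posSqrt S = S :=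
  CFC.sqrt_mul_sqrt_self S ((ContinuousLinearMap.nonneg_iff_isPositive S).mpr hS)

theorem inner_apply_eq_norm_posSqrt_sq (hS : S.IsPositive) (x : H) :
    inner ℂ x (S x) = ((‖posSqrt S x‖ ^ 2 : ℝ) : ℂ) := by
  conv_lhs => rw [← posSqrt_comp_posSqrt hS, ContinuousLinearMap.comp_apply, ← adjoint_posSqrt,
    ContinuousLinearMap.adjoint_inner_right, adjoint_posSqrt, inner_self_eq_norm_sq_to_K]
  norm_cast

theorem hsSq_posSqrt_ne_top (hS : S.IsPositive) (hS' : IsTraceClass S) :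
    hsSq (posSqrt S) ≠ ⊤ := by
  obtain ⟨w, b, h⟩ := hS'
  rw [CFC.abs_of_nonneg S ((ContinuousLinearMap.nonneg_iff_isPositive S).mpr hS)] at h
  simp_rw [inner_apply_eq_norm_posSqrt_sq hS, Complex.ofReal_re] at h
  have h' := h.tsum_ofReal_ne_top
  simp_rw [ENNReal.ofReal_pow (norm_nonneg _), ofReal_norm] at h'
  rwa [hsSq_eq_tsum b]

theorem trace_eq_hsSq_posSqrt (hS : S.IsPositive) :
    trace S = ((hsSq (posSqrt S)).toReal : ℂ) := by
  rw [trace, hsSq, ENNReal.tsum_toReal_eq fun i => by finiteness, Complex.ofReal_tsum]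
  refine tsum_congr fun i => ?_
  rw [inner_apply_eq_norm_posSqrt_sq hS]
  simp

end Sqrt

/-! ### Time-frequency shifts -/

section TimeFrequency

variable {d : ℕ}

theorem coeFn_timeFreqShift (z : Phase d) (f : L2 d) :
    timeFreqShift z f =ᵐ[volume] shiftFun z f :=
  MemLp.coeFn_toLp (memLp_shiftFun z (Lp.memLp f))

theorem norm_timeFreqShift (z : Phase d) (f : L2 d) : ‖timeFreqShift z f‖ = ‖f‖ :=
  (timeFreqShiftₗᵢ z).norm_map f

theorem adjoint_timeFreqShift_comp_self (z : Phase d) :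
    (timeFreqShift z).adjoint ∘L timeFreqShift z = 1 :=
  (ContinuousLinearMap.norm_map_iff_adjoint_comp_self _).mp (norm_timeFreqShift z)

/-- Time-frequency shifts compose up to a phase factor. -/
theorem exists_timeFreqShift_comp (z w : Phase d) :
    ∃ c : ℂ, ‖c‖ = 1 ∧ timeFreqShift z ∘L timeFreqShift w = c • timeFreqShift (z + w) := by
  have hnorm : ∀ r : ℝ, ‖Complex.exp (2 * Real.pi * Complex.I * (r : ℝ))‖ = 1 := fun r => by
    rw [show (2 * Real.pi * Complex.I * (r : ℝ) : ℂ) = ((2 * Real.pi * r : ℝ) : ℂ) * Complex.I by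
      push_cast; ring]
    exact Complex.norm_exp_ofReal_mul_I _
  refine ⟨_, hnorm (-(inner ℝ w.2 z.1)), ContinuousLinearMap.ext fun f => Lp.ext ?_⟩
  rw [ContinuousLinearMap.comp_apply, smul_apply]
  filter_upwards [coeFn_timeFreqShift z (timeFreqShift w f),
    shiftFun_congr z (coeFn_timeFreqShift w f), coeFn_timeFreqShift (z + w) f,
    Lp.coeFn_smul (Complex.exp (2 * Real.pi * Complex.I * ((-(inner ℝ w.2 z.1) : ℝ) : ℂ)))
      (timeFreqShift (z + w) f)] with t h1 h2 h3 h4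
  rw [h1, h2, h4, Pi.smul_apply, h3, smul_eq_mul]
  simp only [shiftFun, Prod.snd_add, Prod.fst_add, sub_add_eq_sub_sub, ← mul_assoc,
    ← Complex.exp_add, inner_add_left, inner_sub_right]
  congr 2
  push_cast
  ring

/-- `π(w)* π(z) = c π(z - w)` with a phase factor `c`. -/
theorem exists_adjoint_timeFreqShift_comp (z w : Phase d) :
    ∃ c : ℂ, ‖c‖ = 1 ∧ (timeFreqShift w).adjoint ∘L timeFreqShift z
      = c • timeFreqShift (z - w) := by
  obtain ⟨c, hc, h⟩ := exists_timeFreqShift_comp w (z - w)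
  have hc0 : c ≠ 0 := norm_ne_zero_iff.mp (by simp [hc])
  refine ⟨c⁻¹, by simp [hc], ?_⟩
  rw [add_sub_cancel] at h
  rw [← inv_smul_smul₀ hc0 (timeFreqShift z), ← h, ContinuousLinearMap.comp_smul,
    ← ContinuousLinearMap.comp_assoc, adjoint_timeFreqShift_comp_self]
  rfl

theorem hsSq_smul {c : ℂ} (hc : ‖c‖ = 1) (A : L2 d →L[ℂ] L2 d) : hsSq (c • A) = hsSq A := by
  refine tsum_congr fun i => ?_
  rw [smul_apply, enorm_smul, ← ofReal_norm, hc]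
  simp

instance : Nontrivial (L2 d) := by
  have hb : volume (Metric.ball (0 : EuclideanSpace ℝ (Fin d)) 1) ≠ ⊤ :=
    measure_ball_lt_top.ne
  refine ⟨indicatorConstLp 2 measurableSet_ball hb (1 : ℂ), 0, norm_ne_zero_iff.mp ?_⟩
  rw [norm_indicatorConstLp (by norm_num) (by norm_num)]
  have h0 : volume (Metric.ball (0 : EuclideanSpace ℝ (Fin d)) 1) ≠ 0 :=
    (Metric.measure_ball_pos _ _ one_pos).ne'
  have hpos : 0 < volume.real (Metric.ball (0 : EuclideanSpace ℝ (Fin d)) 1) :=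
    ENNReal.toReal_pos h0 hb
  have := Real.rpow_pos_of_pos hpos (1 / (2 : ℝ≥0∞).toReal)
  rw [norm_one, one_mul]
  exact this.ne'

end TimeFrequency

/-! ### Density operators -/

section Density

variable {d : ℕ} {Λ : Submodule ℤ (Phase d)} {S : L2 d →L[ℂ] L2 d}

/-- The operators `B_λ = √S π(λ)*`. The products `B_λ* B_λ = π(λ) S π(λ)*` resolve the identity when
`S` is a density operator. -/
noncomputable def frameOp (S : L2 d →L[ℂ] L2 d) (Λ : Submodule ℤ (Phase d)) (z : Λ) :
    L2 d →L[ℂ] L2 d :=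
  posSqrt S ∘L (timeFreqShift (z : Phase d)).adjoint

theorem adjoint_frameOp (z : Λ) :
    (frameOp S Λ z).adjoint = timeFreqShift (z : Phase d) ∘L posSqrt S := by
  rw [frameOp, ContinuousLinearMap.adjoint_comp, ContinuousLinearMap.adjoint_adjoint,
    adjoint_posSqrt]

theorem adjoint_frameOp_comp_self (hS : S.IsPositive) (z : Λ) :
    (frameOp S Λ z).adjoint ∘L frameOp S Λ z = opTranslate z S := by
  rw [adjoint_frameOp, frameOp, opTranslate]
  conv_rhs => rw [← posSqrt_comp_posSqrt hS]
  rfl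

theorem hsSq_frameOp (z : Λ) : hsSq (frameOp S Λ z) = hsSq (posSqrt S) := by
  rw [← hsSq_adjoint, adjoint_frameOp, hsSq_comp_left (norm_timeFreqShift _)]

/-- The frame condition as a resolution of the identity. -/
theorem IsDensityOperator.tsum_enorm_frameOp_sq (hS : IsDensityOperator S Λ) (x : L2 d) :
    ∑' z, ‖frameOp S Λ z x‖ₑ ^ 2 = ‖x‖ₑ ^ 2 := by
  obtain ⟨hpos, -, hf⟩ := hS
  have hc : ∀ z : Λ, cohen S x z = ‖frameOp S Λ z x‖ ^ 2 := fun z => by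
    rw [cohen, inner_apply_eq_norm_posSqrt_sq hpos, Complex.ofReal_re]
    rfl
  have hsum := hf.summable x
  have hle := hf.lower x
  have hge := hf.upper x
  simp_rw [hc, one_mul] at hsum hle hge
  have h := ENNReal.ofReal_tsum_of_nonneg (fun z => by positivity) hsum
  rw [le_antisymm hge hle] at h
  simpa only [ENNReal.ofReal_pow (norm_nonneg _), ofReal_norm] using h.symm

/-- The pairing `tr(S π(z) S π(z)*)` of a positive operator with its translates, written as the
squared Hilbert–Schmidt norm of `√S π(z) √S`. -/
noncomputable def autocorrelation (S : L2 d →L[ℂ] L2 d) (z : Phase d) : ℝ≥0∞ :=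
  hsSq (posSqrt S ∘L timeFreqShift z ∘L posSqrt S)

theorem hsSq_frameOp_comp_adjoint (z w : Λ) :
    hsSq (frameOp S Λ w ∘L (frameOp S Λ z).adjoint) = autocorrelation S (z - w : Λ) := by
  obtain ⟨c, hc, h⟩ := exists_adjoint_timeFreqShift_comp (z : Phase d) w
  have h' : frameOp S Λ w ∘L (frameOp S Λ z).adjoint = posSqrt S ∘L
      ((timeFreqShift (w : Phase d)).adjoint ∘L timeFreqShift (z : Phase d)) ∘L posSqrt S := by
    rw [adjoint_frameOp]
    rfl
  rw [h', h, ContinuousLinearMap.smul_comp, ContinuousLinearMap.comp_smul, hsSq_smul hc]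
  rfl

/-- The autocorrelation sums to the trace of `S`: apply the frame condition to each `√S eᵢ`. -/
theorem IsDensityOperator.tsum_autocorrelation (hS : IsDensityOperator S Λ) :
    ∑' z : Λ, autocorrelation S z = hsSq (posSqrt S) := by
  have h : ∀ z : Λ, autocorrelation S z = hsSq (frameOp S Λ z ∘L posSqrt S) := fun z => by
    rw [← hsSq_adjoint, ContinuousLinearMap.adjoint_comp, adjoint_frameOp, adjoint_posSqrt]
    rfl
  simp_rw [h, hsSq]
  rw [ENNReal.tsum_comm]
  simp_rw [ContinuousLinearMap.comp_apply, hS.tsum_enorm_frameOp_sq]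

theorem IsDensityOperator.hsSq_posSqrt_ne_zero (hS : IsDensityOperator S Λ) :
    hsSq (posSqrt S) ≠ 0 := by
  intro h0
  obtain ⟨x, hx⟩ := exists_ne (0 : L2 d)
  have hQ : posSqrt S = 0 := by
    refine ContinuousLinearMap.ext_on (Submodule.dense_iff_topologicalClosure_eq_top.mpr
      (someBasis (L2 d)).dense_span) ?_
    rintro _ ⟨i, rfl⟩
    simpa using ENNReal.tsum_eq_zero.mp h0 i
  have h := hS.tsum_enorm_frameOp_sq x
  simp [frameOp, hQ] at h
  exact hx (by simpa using h.symm)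

/-- A sum over `F × Fᶜ` of a function of the difference `i - j`, collected by the value `n` of that
difference. -/
theorem sum_tsum_compl_sub {G : Type*} [AddCommGroup G] [DecidableEq G] (F : Finset G)
    (h : G → ℝ≥0∞) :
    ∑ i ∈ F, ∑' j : {j // j ∉ F}, h (i - j)
      = ∑' n, ((F.filter fun i => i - n ∉ F).card : ℝ≥0∞) * h n := by
  have h1 : ∀ i, ∑' j : {j // j ∉ F}, h (i - j) = ∑' n, if i - n ∉ F then h n else 0 := by
    intro i
    refine (tsum_subtype {j | j ∉ F} fun j => h (i - j)).trans ?_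
    rw [← (Equiv.subLeft i).tsum_eq]
    refine tsum_congr fun n => ?_
    simp [Set.indicator_apply]
  simp_rw [h1]
  rw [← Summable.tsum_finsetSum fun _ _ => ENNReal.summable]
  refine tsum_congr fun n => ?_
  rw [← Finset.sum_filter, Finset.sum_const, nsmul_eq_mul]

theorem leakage_frameOp [DecidableEq Λ] (F : Finset Λ) :
    leakage (frameOp S Λ) F
      = ∑' n : Λ, ((F.filter fun i => i - n ∉ F).card : ℝ≥0∞) * autocorrelation S n := by
  rw [← sum_tsum_compl_sub F fun n : Λ => autocorrelation S n, leakage]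
  simp_rw [hsSq_frameOp_comp_adjoint]

end Density

/-! ### Counting lattice points in dilated sets -/

section Lattice

variable {E : Type*} [NormedAddCommGroup E] [NormedSpace ℝ E] [FiniteDimensional ℝ E]
  [MeasurableSpace E] [BorelSpace E]

/-- A lattice has a bounded measurable cell of positive measure that contains exactly one lattice
translate of every point. -/
theorem exists_isBounded_fundamentalDomain (μ : Measure E) [μ.IsAddHaarMeasure]
    (L : Submodule ℤ E) [DiscreteTopology L] [IsZLattice ℝ L] :
    ∃ D : Set E, MeasurableSet D ∧ Bornology.IsBounded D ∧ μ D ≠ 0 ∧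
      ∀ x, ∃! v : L, (v : E) + x ∈ D := by
  have := ZLattice.module_free ℝ L
  have := ZLattice.module_finite ℝ L
  let b := (Module.Free.chooseBasis ℤ L).ofZLatticeBasis ℝ
  have hb : Submodule.span ℤ (Set.range b) = L := Module.Basis.ofZLatticeBasis_span ℝ _ _
  refine ⟨ZSpan.fundamentalDomain b, ZSpan.fundamentalDomain_measurableSet b,
    ZSpan.fundamentalDomain_isBounded b, ZSpan.measure_fundamentalDomain_ne_zero b, fun x => ?_⟩
  have h := ZSpan.exist_unique_vadd_mem_fundamentalDomain b x
  rw [hb] at h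
  exact h

omit [NormedSpace ℝ E] [FiniteDimensional ℝ E] in
/-- Translates of the cell `D` by distinct lattice points are disjoint, so lattice points whose
cells lie in `A` are at most `μ A / μ D` in number. -/
theorem card_mul_measure_le {μ : Measure E} [μ.IsAddHaarMeasure] {L : Submodule ℤ E} {D : Set E}
    (hD : MeasurableSet D) (hD' : ∀ x, ∃! v : L, (v : E) + x ∈ D) (F : Finset L) {A : Set E}
    (hA : ∀ l ∈ F, ∀ f ∈ D, (l : E) + f ∈ A) : F.card * μ D ≤ μ A := by
  have hdisj : (F : Set L).PairwiseDisjoint fun l => (fun x => -(l : E) + x) ⁻¹' D := by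
    intro l _ m _ hlm
    refine Set.disjoint_left.mpr fun x hx hx' => hlm ?_
    exact neg_injective ((hD' x).unique (y₁ := -l) (y₂ := -m) (by simpa using hx)
      (by simpa using hx'))
  calc F.card * μ D = ∑ l ∈ F, μ ((fun x => -(l : E) + x) ⁻¹' D) := by
        simp [measure_preimage_add]
    _ = μ (⋃ l ∈ F, (fun x => -(l : E) + x) ⁻¹' D) :=
        (measure_biUnion_finset hdisj fun l _ => measurable_const_add _ hD).symm
    _ ≤ μ A := measure_mono <| Set.iUnion₂_subset fun l hl x hx => by
        simpa using hA l hl _ hx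

omit [NormedSpace ℝ E] [FiniteDimensional ℝ E] in
/-- Lattice translates of the cell `D` cover the space, so at least `μ A / μ D` of them meet `A`. -/
theorem measure_le_card_mul {μ : Measure E} [μ.IsAddHaarMeasure] {L : Submodule ℤ E} {D : Set E}
    (hD' : ∀ x, ∃! v : L, (v : E) + x ∈ D) (F : Finset L) {A : Set E}
    (hA : ∀ l : L, ∀ f ∈ D, (l : E) + f ∈ A → l ∈ F) : μ A ≤ F.card * μ D := by
  calc μ A ≤ μ (⋃ l ∈ F, (fun x => -(l : E) + x) ⁻¹' D) := measure_mono fun x hx => by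
        obtain ⟨v, hv, -⟩ := hD' x
        simp only [Set.mem_iUnion]
        exact ⟨-v, hA _ _ hv (by simpa using hx), by simpa using hv⟩
    _ ≤ ∑ l ∈ F, μ ((fun x => -(l : E) + x) ⁻¹' D) := measure_biUnion_finset_le _ _
    _ = F.card * μ D := by simp [measure_preimage_add]

omit [FiniteDimensional ℝ E] [MeasurableSpace E] [BorelSpace E] in
theorem exists_mem_segment_frontier {s : Set E} {x y : E} (hx : x ∈ s) (hy : y ∉ s) :
    ∃ p ∈ frontier s, p ∈ segment ℝ x y := by
  by_contra! hne
  have hx' : x ∈ interior s := by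
    by_contra h
    exact hne x ⟨subset_closure hx, h⟩ (left_mem_segment ℝ x y)
  have hy' : y ∉ closure s := fun h =>
    hne y ⟨h, fun h' => hy (interior_subset h')⟩ (right_mem_segment ℝ x y)
  obtain ⟨p, -, hp, hp'⟩ := (convex_segment x y).isPreconnected (interior s) (closure s)ᶜ
    isOpen_interior isClosed_closure.isOpen_compl
    (fun p hp => by
      by_contra h
      rw [Set.mem_union, Set.mem_compl_iff, not_or, not_not] at h
      exact hne p ⟨h.2, h.1⟩ hp)
    ⟨x, left_mem_segment ℝ x y, hx'⟩ ⟨y, right_mem_segment ℝ x y, hy'⟩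
  exact hp' (interior_subset_closure hp)

/-- A positive proportion of the volume of a dilated ball is accounted for by lattice points of the
dilated set. -/
theorem eventually_pow_mul_le_card {μ : Measure E} [μ.IsAddHaarMeasure] {L : Submodule ℤ E}
    {D : Set E} (hDb : Bornology.IsBounded D) (hD' : ∀ x, ∃! v : L, (v : E) + x ∈ D) {Ω : Set E}
    {x₀ : E} {r : ℝ} (hr : 0 < r) (hball : Metric.ball x₀ r ⊆ Ω) {F : ℝ → Finset L}
    (hF : ∀ R > 0, ∀ l, l ∈ F R ↔ (l : E) ∈ R • Ω) :
    ∀ᶠ R : ℝ in atTop, ENNReal.ofReal (R ^ Module.finrank ℝ E) * μ (Metric.ball x₀ (r / 2))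
      ≤ (F R).card * μ D := by
  obtain ⟨M, hM, hDM⟩ := hDb.exists_pos_norm_le
  -- For `R ≥ 2M/r` the rescaled cells have radius at most `r/2`, so a lattice point whose cell
  -- meets the ball of radius `r/2` lies in the ball of radius `r`.
  filter_upwards [eventually_gt_atTop 0, eventually_ge_atTop (2 * M / r)] with R hR hRM
  have h := Measure.addHaar_smul μ R (Metric.ball x₀ (r / 2))
  rw [abs_of_pos (by positivity)] at h
  rw [← h]
  refine measure_le_card_mul hD' _ fun l f hf hlf => (hF R hR l).mpr ?_
  rw [Set.mem_smul_set_iff_inv_smul_mem₀ hR.ne'] at hlf ⊢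
  apply hball
  rw [mem_ball_iff_norm] at hlf ⊢
  have h1 : ‖R⁻¹ • f‖ ≤ r / 2 := by
    rw [norm_smul, norm_inv, Real.norm_of_nonneg hR.le, inv_mul_le_iff₀ hR]
    rw [div_le_iff₀ hr] at hRM
    linarith [hDM f hf]
  calc ‖R⁻¹ • (l : E) - x₀‖ = ‖(R⁻¹ • ((l : E) + f) - x₀) - R⁻¹ • f‖ := by
        rw [smul_add]; congr 1; abel
    _ ≤ ‖R⁻¹ • ((l : E) + f) - x₀‖ + ‖R⁻¹ • f‖ := norm_sub_le _ _
    _ < r := by linarith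

/-- The cells of the lattice points that leave `R • Ω` under translation by `-n` lie within bounded
distance of the boundary of `R • Ω`. -/
theorem card_filter_mul_le {μ : Measure E} [μ.IsAddHaarMeasure] {L : Submodule ℤ E} [DecidableEq L]
    {D : Set E} (hDm : MeasurableSet D) {M : ℝ} (hDM : ∀ f ∈ D, ‖f‖ ≤ M)
    (hD' : ∀ x, ∃! v : L, (v : E) + x ∈ D) {Ω : Set E} {F : ℝ → Finset L}
    (hF : ∀ R > 0, ∀ l, l ∈ F R ↔ (l : E) ∈ R • Ω) (n : L) {R : ℝ} (hR : 0 < R) :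
    ((F R).filter fun i => i - n ∉ F R).card * μ D ≤ ENNReal.ofReal (R ^ Module.finrank ℝ E) *
      μ (Metric.cthickening ((‖(n : E)‖ + M) / R) (frontier Ω)) := by
  have h := Measure.addHaar_smul μ R (Metric.cthickening ((‖(n : E)‖ + M) / R) (frontier Ω))
  rw [abs_of_pos (by positivity)] at h
  rw [← h]
  refine card_mul_measure_le hDm hD' _ fun l hl f hf => ?_
  rw [Finset.mem_filter, hF R hR, hF R hR, Set.mem_smul_set_iff_inv_smul_mem₀ hR.ne',
    Set.mem_smul_set_iff_inv_smul_mem₀ hR.ne'] at hl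
  obtain ⟨p, hp, hps⟩ := exists_mem_segment_frontier hl.1 hl.2
  rw [Set.mem_smul_set_iff_inv_smul_mem₀ hR.ne']
  refine Metric.mem_cthickening_of_dist_le _ p _ _ hp ?_
  have h1 : ‖p - R⁻¹ • (l : E)‖ ≤ R⁻¹ * ‖(n : E)‖ := by
    have h := norm_sub_le_of_mem_segment hps
    rw [← smul_sub, norm_smul, norm_inv, Real.norm_of_nonneg hR.le] at h
    simpa using h
  have h2 : ‖R⁻¹ • f‖ ≤ R⁻¹ * M := by
    rw [norm_smul, norm_inv, Real.norm_of_nonneg hR.le]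
    exact mul_le_mul_of_nonneg_left (hDM f hf) (by positivity)
  rw [dist_eq_norm]
  calc ‖R⁻¹ • ((l : E) + f) - p‖ = ‖R⁻¹ • f - (p - R⁻¹ • (l : E))‖ := by
        rw [smul_add]; congr 1; abel
    _ ≤ ‖R⁻¹ • f‖ + ‖p - R⁻¹ • (l : E)‖ := norm_sub_le _ _
    _ ≤ (‖(n : E)‖ + M) / R := by rw [div_eq_inv_mul, mul_add]; linarith

/-- Lattice points of `R • Ω` that a fixed lattice translation moves out of `R • Ω` are a
vanishing proportion, because `∂Ω` is a null set. -/
theorem tendsto_card_filter_div_card (μ : Measure E) [μ.IsAddHaarMeasure] {L : Submodule ℤ E}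
    [DecidableEq L] [DiscreteTopology L] [IsZLattice ℝ L] {Ω : Set E} (hΩ : IsCompact Ω)
    (hint : (interior Ω).Nonempty) (hbd : μ (frontier Ω) = 0) {F : ℝ → Finset L}
    (hF : ∀ R > 0, ∀ l, l ∈ F R ↔ (l : E) ∈ R • Ω) :
    (∀ᶠ R in atTop, 0 < (F R).card) ∧ ∀ n, Tendsto
      (fun R => (((F R).filter fun i => i - n ∉ F R).card : ℝ) / (F R).card) atTop (𝓝 0) := by
  obtain ⟨D, hDm, hDb, hD0, hD'⟩ := exists_isBounded_fundamentalDomain μ L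
  obtain ⟨M, hM, hDM⟩ := hDb.exists_pos_norm_le
  obtain ⟨x₀, hx₀⟩ := hint
  obtain ⟨r, hr, hball⟩ := Metric.isOpen_iff.mp isOpen_interior x₀ hx₀
  have hlow := eventually_pow_mul_le_card (μ := μ) hDb hD' hr (hball.trans interior_subset) hF
  set β := μ (Metric.ball x₀ (r / 2))
  have hβ0 : β ≠ 0 := (Metric.measure_ball_pos μ _ (by positivity)).ne'
  have hβ : β ≠ ⊤ := measure_ball_lt_top.ne
  have hDtop : μ D ≠ ⊤ := hDb.measure_lt_top.ne
  refine ⟨?_, fun n => ?_⟩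
  · filter_upwards [hlow, eventually_gt_atTop 0] with R h hR
    refine Nat.pos_of_ne_zero fun h0 => ?_
    rw [h0, Nat.cast_zero, zero_mul, nonpos_iff_eq_zero, mul_eq_zero, ENNReal.ofReal_eq_zero] at h
    exact h.elim (not_le.mpr (by positivity)) hβ0
  · have hc : Tendsto (fun R : ℝ => (‖(n : E)‖ + M) / R) atTop (𝓝 0) :=
      tendsto_const_nhds.div_atTop tendsto_id
    have hfr : IsCompact (frontier Ω) :=
      hΩ.of_isClosed_subset isClosed_frontier hΩ.isClosed.frontier_subset
    have hg := (tendsto_measure_cthickening_of_isCompact (μ := μ) hfr).comp hc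
    rw [hbd] at hg
    have hg' := ((ENNReal.tendsto_toReal ENNReal.zero_ne_top).comp hg).div_const β.toReal
    rw [ENNReal.toReal_zero, zero_div] at hg'
    refine squeeze_zero' (Eventually.of_forall fun R => by positivity) ?_ hg'
    filter_upwards [hlow, eventually_gt_atTop 0] with R h hR
    have h2 := card_filter_mul_le (μ := μ) hDm hDM hD' hF n hR
    simp only [Function.comp_apply]
    set g := μ (Metric.cthickening ((‖(n : E)‖ + M) / R) (frontier Ω))
    have hgtop : g ≠ ⊤ := hfr.isBounded.cthickening.measure_lt_top.ne
    have h3 : (((F R).filter fun i => i - n ∉ F R).card : ℝ≥0∞) * β ≤ (F R).card * g := by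
      rw [← ENNReal.mul_le_mul_iff_left hD0 hDtop]
      calc _ = (((F R).filter fun i => i - n ∉ F R).card * μ D) * β := by ring
        _ ≤ (ENNReal.ofReal (R ^ Module.finrank ℝ E) * g) * β := by gcongr
        _ = (ENNReal.ofReal (R ^ Module.finrank ℝ E) * β) * g := by ring
        _ ≤ ((F R).card * μ D) * g := by gcongr
        _ = _ := by ring
    have h4 := ENNReal.toReal_mono (by finiteness) h3
    simp only [ENNReal.toReal_mul, ENNReal.toReal_natCast] at h4
    have hβpos : 0 < β.toReal := ENNReal.toReal_pos hβ0 hβ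
    refine div_le_of_le_mul₀ (by positivity) (by positivity) ?_
    rw [div_mul_eq_mul_div, le_div_iff₀ hβpos, mul_comm g.toReal]
    exact h4

end Lattice

/-! ### Asymptotics of the eigenvalue count -/

section Main

variable {d : ℕ} {Λ : Submodule ℤ (Phase d)} {S : L2 d →L[ℂ] L2 d}

theorem finite_lattice_inter [DiscreteTopology Λ] {K : Set (Phase d)} (hK : IsCompact K) :
    {l : Λ | (l : Phase d) ∈ K}.Finite := by
  have h : (K ∩ (Λ : Set (Phase d))).Finite :=
    Metric.finite_isBounded_inter_isClosed DiscreteTopology.isDiscrete hK.isBounded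
      (AddSubgroup.isClosed_of_discrete (H := Λ.toAddSubgroup))
  exact (h.preimage Subtype.val_injective.injOn).subset fun l hl => ⟨hl, l.2⟩

/-- The lattice points of a compact set. -/
noncomputable def latticePoints [DiscreteTopology Λ] {K : Set (Phase d)} (hK : IsCompact K) :
    Finset Λ :=
  (finite_lattice_inter hK).toFinset

theorem coe_map_latticePoints [DiscreteTopology Λ] {K : Set (Phase d)} (hK : IsCompact K) :
    (((latticePoints hK : Finset Λ).map (Function.Embedding.subtype _) : Finset (Phase d)) :
      Set (Phase d)) = K ∩ (Λ : Set (Phase d)) := by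
  ext x
  simp [latticePoints, and_comm]

theorem ncard_inter_eq_card_latticePoints [DiscreteTopology Λ] {K : Set (Phase d)}
    (hK : IsCompact K) :
    (K ∩ (Λ : Set (Phase d))).ncard = (latticePoints hK : Finset Λ).card := by
  rw [← coe_map_latticePoints hK, Set.ncard_coe_finset, Finset.card_map]

theorem gaborMultiplier_eq_partialFrameOp [DiscreteTopology Λ] (hS : S.IsPositive)
    {K : Set (Phase d)} (hK : IsCompact K) :
    gaborMultiplier S Λ K = partialFrameOp (frameOp S Λ) (latticePoints hK) := by
  rw [gaborMultiplier, ← coe_map_latticePoints hK, finsum_mem_coe_finset, Finset.sum_map,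
    partialFrameOp]
  exact Finset.sum_congr rfl fun l _ => (adjoint_frameOp_comp_self hS l).symm

/-- The trace of `G - G²` for the Gabor multiplier `G` of `R • Ω` is of smaller order than the
number of lattice points in `R • Ω`: by `leakage_frameOp` the quotient is an average of the summable
function `autocorrelation S` against proportions tending to zero. -/
theorem IsDensityOperator.tendsto_leakage_div_card [DecidableEq Λ] (hS : IsDensityOperator S Λ)
    {F : ℝ → Finset Λ} (hF : ∀ n, Tendsto
      (fun R => (((F R).filter fun i => i - n ∉ F R).card : ℝ) / (F R).card) atTop (𝓝 0)) :
    Tendsto (fun R => (leakage (frameOp S Λ) (F R)).toReal / (F R).card) atTop (𝓝 0) := by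
  have htop : ∑' z : Λ, autocorrelation S z ≠ ⊤ :=
    hS.tsum_autocorrelation ▸ hsSq_posSqrt_ne_top hS.1 hS.2.1
  have heq : ∀ R, (leakage (frameOp S Λ) (F R)).toReal / (F R).card = ∑' n : Λ,
      (((F R).filter fun i => i - n ∉ F R).card : ℝ) / (F R).card
        * (autocorrelation S n).toReal := by
    intro R
    rw [leakage_frameOp, ENNReal.tsum_toReal_eq fun n => ENNReal.mul_ne_top
      (ENNReal.natCast_ne_top _) (ENNReal.ne_top_of_tsum_ne_top htop n), ← tsum_div_const]
    refine tsum_congr fun n => ?_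
    rw [ENNReal.toReal_mul, ENNReal.toReal_natCast]
    ring
  simp_rw [heq]
  have h := tendsto_tsum_of_dominated_convergence (𝓕 := atTop) (g := fun _ : Λ => (0 : ℝ))
    (f := fun R (n : Λ) => (((F R).filter fun i => i - n ∉ F R).card : ℝ) / (F R).card
      * (autocorrelation S n).toReal)
    (ENNReal.summable_toReal htop) (fun n => by simpa using (hF n).mul_const _)
    (Eventually.of_forall fun R n => ?_)
  · simpa using h
  · rw [Real.norm_of_nonneg (by positivity)]
    refine mul_le_of_le_one_left ENNReal.toReal_nonneg (div_le_one_of_le₀ ?_ (by positivity))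
    exact_mod_cast Finset.card_filter_le _ _

end Main
end GaborMultiplier

open GaborMultiplier in
theorem mainTheorem1 (d : ℕ) (Λ : Submodule ℤ (GaborMultiplier.Phase d)) [DiscreteTopology Λ]
    [IsZLattice ℝ Λ] (S : GaborMultiplier.L2 d →L[ℂ] GaborMultiplier.L2 d)
    (hS : GaborMultiplier.IsDensityOperator S Λ)
    (Ω : Set (GaborMultiplier.Phase d)) (hΩ : IsCompact Ω)
    (hint : (interior Ω).Nonempty) (hbd : volume (frontier Ω) = 0)
    (δ : ℝ) (hδ : δ ∈ Set.Ioo (0 : ℝ) 1) :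
    Tendsto
      (fun R : ℝ =>
        (GaborMultiplier.eigenvalueCount (GaborMultiplier.gaborMultiplier S Λ (R • Ω)) (1 - δ) : ℂ)
          / (((R • Ω ∩ (Λ : Set (GaborMultiplier.Phase d))).ncard : ℂ) *
            GaborMultiplier.trace S))
      atTop (𝓝 1) := by
  classical
  let F : ℝ → Finset Λ := fun R => latticePoints (hΩ.smul R)
  have : (volume : Measure (Phase d)).IsAddHaarMeasure :=
    inferInstanceAs ((volume : Measure (EuclideanSpace ℝ (Fin d))).prod volume).IsAddHaarMeasure
  obtain ⟨hpos, hF⟩ := tendsto_card_filter_div_card (volume : Measure (Phase d)) hΩ hint hbd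
    (F := F) fun R _ l => by simp [F, latticePoints]
  set τ := hsSq (posSqrt S)
  have hτtop : τ ≠ ⊤ := hsSq_posSqrt_ne_top hS.1 hS.2.1
  have hτ : 0 < τ.toReal := ENNReal.toReal_pos hS.hsSq_posSqrt_ne_zero hτtop
  set count : ℝ → ℕ := fun R => eigenvalueCount (gaborMultiplier S Λ (R • Ω)) (1 - δ)
  have hbound : ∀ R, |(count R : ℝ) - (F R).card * τ.toReal|
      ≤ (1 / δ + 1 / (1 - δ)) * (leakage (frameOp S Λ) (F R)).toReal := by
    intro R
    have h := abs_eigenvalueCount_sub_le (F := F R) hS.tsum_enorm_frameOp_sq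
      (fun i _ => (hsSq_frameOp i).trans_ne hτtop) hδ
    simp only [hsSq_frameOp, Finset.sum_const, nsmul_eq_mul, ENNReal.toReal_mul,
      ENNReal.toReal_natCast] at h
    rwa [← gaborMultiplier_eq_partialFrameOp hS.1] at h
  have hreal : Tendsto (fun R => (count R : ℝ) / ((F R).card * τ.toReal)) atTop (𝓝 1) := by
    rw [tendsto_iff_norm_sub_tendsto_zero]
    have h0 := ((hS.tendsto_leakage_div_card hF).const_mul (1 / δ + 1 / (1 - δ))).div_const τ.toReal
    rw [mul_zero, zero_div] at h0
    refine squeeze_zero' (Eventually.of_forall fun _ => norm_nonneg _) ?_ h0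
    filter_upwards [hpos] with R hR
    have hR' : (0 : ℝ) < (F R).card := by exact_mod_cast hR
    rw [div_sub_one (by positivity), Real.norm_eq_abs, abs_div, abs_of_pos (mul_pos hR' hτ),
      ← mul_div_assoc, div_div]
    exact div_le_div_of_nonneg_right (hbound R) (by positivity)
  have hcomplex := (Complex.continuous_ofReal.tendsto 1).comp hreal
  refine (hcomplex.congr fun R => ?_)
  simp only [Function.comp_apply, count, F, trace_eq_hsSq_posSqrt hS.1,
    ncard_inter_eq_card_latticePoints (hΩ.smul R)]
  push_cast
  rfl
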